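/- Let $\mathcal A$ be an abelian category and $S$ a non-empty finite set. An *$S$-cube* in a category is a contravariant functor from the power set $\mathcal P(S)$ (ordered by inclusion, identified with $[1]^S$, $[1]=\{0,1\}$); a *double $S$-cube* is a contravariant functor from the poset $[2]^S$ of maps $S\to[2]=\{0,1,2\}$ with the pointwise order. For disjoint $U,V\subset S$, $x_{U,V}$ is the value of a double $S$-cube $x$ at the map equal to $1$ on $U$, $2$ on $V$ and $0$ elsewhere. For $T\subset S$ put $e_T^*x=x\circ e_T$ and $\mathbf 2^*x=x\circ\mathbf 2$, where $e_T(U)=\chi_U+\chi_T$ and $\mathbf 2(U)=2\chi_U$ for $U\subset S$. A (double) cube is *monic* if all its structure morphisms are monomorphisms. For an $S$-cube $y$ and $k\in S$, let $d^k$ be the morphism, from the $S\smallsetminus\{k\}$-cube $y|^{\{k\}}:T\mapsto y_{T\cup\{k\}}$ to the $S\smallsetminus\{k\}$-cube $y|^{\emptyset}:T\mapsto y_T$, given by the structure morphisms of $y$, and let $H_0^k(y)$ be the $S\smallsetminus\{k\}$-cube $T\mapsto\operatorname{coker}(y_{T\cup\{k\}}\to y_T)$. The cube $y$ is *admissible*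 if it is monic and, when $\#S>1$, $H_0^k(y)$ is admissible for every $k\in S$ (induction on $\#S\ge1$). For a family $\mathfrak x=\{x_s\to z\}_{s\in S}$, $\operatorname{Fib}\mathfrak x$ is the $S$-cube whose vertex at $T$ is the fibre product over $z$ of the $x_s$, $s\in T$ (and $z$ at $T=\emptyset$). An $S$-cube $y$ is *fibered* if the canonical morphism $y\to\operatorname{Fib}\{y_{\{s\}}\to y_\emptyset\}_{s\in S}$ is an isomorphism. $\operatorname{Tot}y$ is the total chain complex of $y$ (for a fixed total ordering of $S$), with $\bigoplus_{\#T=k}y_T$ in degree $k$ and differential with components $(-1)^{\#\{t\in T:\,t>j\}}\,(y_T\to y_{T\smallsetminus\{j\}})$, $j\in T$. **Theorem.** Let $x$ be a double $S$-cube in $\mathcal A$ such that 1. the $S$-cube $\mathbf 2^*x$ is admissible; 2. $x$ is monic; 3. the $S$-cube $e_T^*x$ is fibered for every proper subset $T$ of $S$; 4. for any subset $W$ of $S$, any non-empty disjoint subsets $U,V$ of $S$ with $W\cup U\ne S$, and any $s\in S\smallsetminus(W\cup U)$ and $v\in V$ with $s\ne v$, put $V'=V\smallsetminus\{v\}$ and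 let $\mathfrak x$ be the family, indexed by $U\sqcup\{s\}$, consisting of the morphisms $$x_{W\smallsetminus(V\cup\{k\}),\,V\cup\{k\}}\to x_{W\smallsetminus V',\,V'}\quad(k\in U),\qquad x_{(W\cup\{s\})\smallsetminus V',\,V'}\to x_{W\smallsetminus V',\,V'}$$ given by $x$ (the last one is the identity if $s\in V'$). Then the morphism $$H_0\operatorname{Tot}d^{s}\colon H_0\operatorname{Tot}\big((\operatorname{Fib}\mathfrak x)|^{\{s\}}\big)\to H_0\operatorname{Tot}\big((\operatorname{Fib}\mathfrak x)|^{\emptyset}\big)$$ between the total complexes of the two $s$-faces (which are $U$-cubes) is a monomorphism. Then the $S$-cube $e_S^*x$ is admissible. -/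

import Mathlib

open CategoryTheory CategoryTheory.Limits Opposite

universe w v u

noncomputable section

namespace Cubes

/-- The poset `P ^ S` of maps from `S` to `P` with the pointwise order, regarded as a category
through this order. -/
def Pow (S : Type w) (P : Type*) := S → P

instance (S : Type w) (P : Type*) [Preorder P] : Preorder (Pow S P) :=
  inferInstanceAs (Preorder (S → P))

/-- An `(S, P)`-cube in `D`: a contravariant functor from the poset `P ^ S` to `D`. -/
abbrev PCube (S : Type w) (P : Type*) [Preorder P] (D : Type u) [Category.{v} D] :=
  (Pow S P)ᵒᵖ ⥤ D

/-- An `S`-cube, with `[1] ^ S` identified with the power set of `S` ordered by inclusion. -/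
abbrev Cube (S : Type w) (D : Type u) [Category.{v} D] := (Set S)ᵒᵖ ⥤ D

/-- A double `S`-cube is an `(S, [2])`-cube, `[2] = {0, 1, 2}`. -/
abbrev DCube (S : Type w) (D : Type u) [Category.{v} D] := PCube S (Fin 3) D

/-- A (possibly double) cube is monic when all its structure morphisms are monomorphisms. -/
def IsMonic {I : Type*} [Preorder I] {D : Type u} [Category.{v} D] (x : Iᵒᵖ ⥤ D) : Prop :=
  ∀ ⦃i j : I⦄ (h : i ≤ j), Mono (x.map (homOfLE h).op)

section DoublePowerSet

variable {S : Type w}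

open Classical in
/-- The characteristic function `χ_{U,V} : S → [2]` of a pair of (disjoint) subsets:
`2` on `V`, `1` on `U`, `0` elsewhere. -/
def chi (U V : Set S) : Pow S (Fin 3) :=
  fun s => if s ∈ V then 2 else if s ∈ U then 1 else 0

theorem chi_le_chi {U V U' V' : Set S} (hV : V ⊆ V') (hU : U ⊆ U' ∪ V') :
    chi U V ≤ chi U' V' := by
  classical
  intro s
  unfold chi
  by_cases h1 : s ∈ V
  · simp [h1, hV h1]
  · by_cases h2 : s ∈ U
    · rcases hU h2 with h | h
      · by_cases h3 : s ∈ V' <;> simp [h1, h2, h, h3]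
      · simp [h1, h2, h]
    · simp [h1, h2]

open Classical in
/-- The order preserving map `𝟐 : [1] ^ S → [2] ^ S`, `f ↦ 2 f`. -/
def twoMap (S : Type w) : Set S →o Pow S (Fin 3) where
  toFun U := fun s : S => if s ∈ U then 2 else 0
  monotone' U U' h s := by
    by_cases h1 : s ∈ U
    · simp [h1, h h1]
    · simp [h1]

open Classical in
/-- The order preserving map `e_T : [1] ^ S → [2] ^ S`, `f ↦ f + χ_T`. -/
def eMap (T : Set S) : Set S →o Pow S (Fin 3) where
  toFun U := fun s : S => (if s ∈ U then 1 else 0) + (if s ∈ T then 1 else 0)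
  monotone' U U' h s := by
    by_cases h1 : s ∈ U
    · simp [h1, h h1]
    · by_cases h2 : s ∈ U' <;> by_cases h3 : s ∈ T <;> simp [h1, h2, h3]

open Classical in
theorem twoMap_apply (U : Set S) (s : S) : twoMap S U s = if s ∈ U then 2 else 0 := rfl

open Classical in
theorem eMap_apply (T U : Set S) (s : S) :
    eMap T U s = (if s ∈ U then 1 else 0) + (if s ∈ T then 1 else 0) := rfl

end DoublePowerSet

/-- Pull-back of a cube along an order preserving map of the indexing posets. -/
def pullback {I J : Type*} [Preorder I] [Preorder J] {D : Type u} [Category.{v} D]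
    (f : I →o J) (x : Jᵒᵖ ⥤ D) : Iᵒᵖ ⥤ D :=
  f.monotone.functor.op ⋙ x

section Faces

variable {S : Type w} {D : Type u} [Category.{v} D]

/-- The map `T ↦ T ∪ V` from subsets of `S ∖ {k}` to subsets of `S`. -/
def faceMap (k : S) (V : Set S) : Set {t : S // t ≠ k} →o Set S where
  toFun T := Subtype.val '' T ∪ V
  monotone' _ _ h := Set.union_subset_union_left V (Set.image_mono h)

/-- The frontside `k`-face, an `S ∖ {k}`-cube with vertices `x_T`. -/
def frontFace (k : S) (x : Cube S D) : Cube {t : S // t ≠ k} D :=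
  pullback (faceMap k ∅) x

/-- The backside `k`-face, an `S ∖ {k}`-cube with vertices `x_{T ∪ {k}}`. -/
def backFace (k : S) (x : Cube S D) : Cube {t : S // t ≠ k} D :=
  pullback (faceMap k {k}) x

theorem faceMap_le (k : S) (T : Set {t : S // t ≠ k}) : faceMap k ∅ T ≤ faceMap k {k} T :=
  Set.union_subset_union_right _ (Set.empty_subset _)

/-- The morphism `d^k` from the backside to the frontside `k`-face, made of the boundary
morphisms `x_{T ∪ {k}} ⟶ x_T`. -/
def boundary (k : S) (x : Cube S D) : backFace k x ⟶ frontFace k x where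
  app T := x.map (homOfLE (faceMap_le k T.unop)).op
  naturality T T' f := by
    dsimp [backFace, frontFace, pullback]
    rw [← x.map_comp, ← x.map_comp]
    rfl

end Faces

section Admissible

variable {A : Type u} [Category.{v} A] [Abelian A]

/-- The `k`-direction `0`-th homology: the `S ∖ {k}`-cube
`T ↦ coker (d^k : x_{T ∪ {k}} ⟶ x_T)`. -/
def dirHomology {S : Type w} (k : S) (x : Cube S A) : Cube {t : S // t ≠ k} A where
  obj T := cokernel ((boundary k x).app T)
  map f := cokernel.map _ _ ((backFace k x).map f) ((frontFace k x).map f)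
    ((boundary k x).naturality f).symm
  map_id T := by
    apply coequalizer.hom_ext
    simp
  map_comp f g := by
    apply coequalizer.hom_ext
    simp

/-- Admissible cubes, by induction on `#S ≥ 1`. -/
inductive IsAdmissible : {S : Type w} → Cube S A → Prop
  | one {S : Type w} (x : Cube S A) (hS : Nat.card S = 1) (hx : IsMonic x) : IsAdmissible x
  | step {S : Type w} (x : Cube S A) (hS : 1 < Nat.card S) (hx : IsMonic x)
      (hk : ∀ k : S, IsAdmissible (dirHomology k x)) : IsAdmissible x

end Admissible

section Fibered

variable {D : Type u} [Category.{v} D] [HasFiniteLimits D]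

instance hasWidePullbackFinite {J : Type w} [Finite J] (B : D) (X : J → D)
    (f : ∀ j, X j ⟶ B) : HasWidePullback B X f := by
  classical
  have := Fintype.ofFinite J
  have : HasLimitsOfShape (WidePullbackShape J) D := hasLimitsOfShape_of_hasFiniteLimits D _
  exact inferInstanceAs (HasLimit _)

variable {S : Type w} [Finite S]

/-- The `S`-cube `Fib` of a family of morphisms `f s : X s ⟶ B`: its vertex at `T` is the fibre
product over `B` of the `X s`, `s ∈ T` (the remaining factors being `B` itself, they are left out;
the vertex at `∅` is `B`), and its structure morphisms are the projections. -/
def fib {B : D} {X : S → D} (f : ∀ s, X s ⟶ B) : Cube S D where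
  obj T := widePullback B (fun s : T.unop => X s) (fun s => f s)
  map {T T'} h := WidePullback.lift (WidePullback.base _)
    (fun s => WidePullback.π (fun s : T.unop => f s) ⟨s.1, leOfHom h.unop s.2⟩)
    (fun s => WidePullback.π_arrow (fun s : T.unop => f s) ⟨s.1, leOfHom h.unop s.2⟩)
  map_id T := by
    apply WidePullback.hom_ext
    · intro s
      rw [WidePullback.lift_π, Category.id_comp]
    · rw [WidePullback.lift_base, Category.id_comp]
  map_comp g h := by
    apply WidePullback.hom_ext
    · intro s
      rw [WidePullback.lift_π, Category.assoc, WidePullback.lift_π, WidePullback.lift_π]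
    · rw [WidePullback.lift_base, Category.assoc, WidePullback.lift_base, WidePullback.lift_base]

/-- The covering of `x_∅` by the `x_{s} ⟶ x_∅` that is associated with a cube `x`. -/
def cov (x : Cube S D) (s : S) : x.obj (op {s}) ⟶ x.obj (op ∅) :=
  x.map (homOfLE (Set.empty_subset {s})).op

/-- The canonical morphism `C(x)` from `x` to `Fib` of its covering. -/
def toFib (x : Cube S D) : x ⟶ fib (cov x) where
  app T := WidePullback.lift (x.map (homOfLE (Set.empty_subset T.unop)).op)
    (fun s => x.map (homOfLE (Set.singleton_subset_iff.2 s.2)).op)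
    (fun s => by
      rw [cov, ← x.map_comp]
      rfl)
  naturality T T' h := by
    apply WidePullback.hom_ext
    · intro s
      dsimp only [fib]
      rw [Category.assoc, Category.assoc, WidePullback.lift_π, WidePullback.lift_π,
        WidePullback.lift_π, ← x.map_comp]
      rfl
    · dsimp only [fib]
      rw [Category.assoc, Category.assoc, WidePullback.lift_base, WidePullback.lift_base,
        WidePullback.lift_base, ← x.map_comp]
      rfl

/-- A cube is fibered when the canonical morphism `C(x)` is an isomorphism. -/
def IsFibered (x : Cube S D) : Prop := IsIso (toFib x)

end Fibered

section Tot

variable {A : Type u} [Category.{v} A] [Preadditive A] [HasFiniteBiproducts A]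
variable {S : Type w} [LinearOrder S]

/-- For `T' = T ∖ {j}`, the sign `(-1) ^ #{t ∈ T | j < t}`. -/
def totSign (T T' : Set S) : ℤ := (-1) ^ {t ∈ T | ∃ j ∈ T \ T', j < t}.ncard

open Classical in
/-- The component `x_T ⟶ x_{T'}` of the differential: if `T' ⊆ T` (hence `T' = T ∖ {j}`, as this
is only used when `#T = #T' + 1`), it is the boundary morphism with its sign, otherwise it is
zero. -/
def totComp (x : Cube S A) (T T' : Set S) : x.obj (op T) ⟶ x.obj (op T') :=
  if h : T' ≤ T then totSign T T' • x.map (homOfLE h).op else 0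

theorem sum_totSign [Finite S] (T T'' : Set S) (n : ℕ) (hT : T.ncard = n + 2)
    (hT'' : T''.ncard = n) (h : T'' ⊆ T) [Fintype {T' : Set S // T'.ncard = n + 1}]
    [∀ T' : Set S, Decidable (T' ⊆ T ∧ T'' ⊆ T')] :
    (∑ T' : {T' : Set S // T'.ncard = n + 1},
      if T'.1 ⊆ T ∧ T'' ⊆ T'.1 then totSign T T'.1 * totSign T'.1 T'' else 0) = 0 := by
  classical
  have hd : (T \ T'').ncard = 2 := by
    rw [Set.ncard_sdiff h, hT, hT'']; omega
  have key : ∃ i j, i < j ∧ T \ T'' = {i, j} := by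
    obtain ⟨i, j, hij, e⟩ := Set.ncard_eq_two.1 hd
    rcases lt_or_gt_of_ne hij with h1 | h1
    · exact ⟨i, j, h1, e⟩
    · exact ⟨j, i, h1, by rw [e, Set.pair_comm]⟩
  obtain ⟨i, j, hij, e⟩ := key
  have hi : i ∈ T \ T'' := by rw [e]; simp
  have hj : j ∈ T \ T'' := by rw [e]; simp
  have hTe : ∀ t, t ∈ T ↔ t ∈ T'' ∨ t = i ∨ t = j := by
    intro t
    have := Set.ext_iff.1 e t
    simp only [Set.mem_sdiff, Set.mem_insert_iff, Set.mem_singleton_iff] at this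
    have h2 := @h t
    tauto
  have ci : (insert i T'').ncard = n + 1 := by rw [Set.ncard_insert_of_notMem hi.2, hT'']
  have cj : (insert j T'').ncard = n + 1 := by rw [Set.ncard_insert_of_notMem hj.2, hT'']
  have hne : (⟨insert i T'', ci⟩ : {T' : Set S // T'.ncard = n + 1}) ≠ ⟨insert j T'', cj⟩ := by
    intro h0
    have h1 : i ∈ insert j T'' := by
      rw [← Subtype.mk.inj h0]; simp
    rcases h1 with h1 | h1
    · exact hij.ne h1
    · exact hi.2 h1
  rw [Finset.sum_eq_add_of_mem _ _ (Finset.mem_univ _) (Finset.mem_univ _) hne]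
  · have s1 : (insert i T'' : Set S) ⊆ T := Set.insert_subset hi.1 h
    have s2 : (insert j T'' : Set S) ⊆ T := Set.insert_subset hj.1 h
    simp only [s1, s2, Set.subset_insert, and_self, if_true, totSign]
    have a1 : {t ∈ T | ∃ k ∈ T \ insert i T'', k < t} = {t ∈ T'' | j < t} := by
      ext t
      simp only [Set.mem_ofPred_eq, Set.mem_sdiff, Set.mem_insert_iff, hTe]
      grind
    have a2 : {t ∈ (insert i T'' : Set S) | ∃ k ∈ (insert i T'' : Set S) \ T'', k < t}
        = {t ∈ T'' | i < t} := by
      ext t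
      simp only [Set.mem_ofPred_eq, Set.mem_sdiff, Set.mem_insert_iff]
      grind
    have a3 : {t ∈ T | ∃ k ∈ T \ insert j T'', k < t} = insert j {t ∈ T'' | i < t} := by
      ext t
      simp only [Set.mem_ofPred_eq, Set.mem_sdiff, Set.mem_insert_iff, hTe]
      grind
    have a4 : {t ∈ (insert j T'' : Set S) | ∃ k ∈ (insert j T'' : Set S) \ T'', k < t}
        = {t ∈ T'' | j < t} := by
      ext t
      simp only [Set.mem_ofPred_eq, Set.mem_sdiff, Set.mem_insert_iff]
      grind
    rw [a1, a2, a3, a4, Set.ncard_insert_of_notMem (fun h0 => hj.2 h0.1)]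
    ring
  · rintro ⟨T', cT'⟩ - ⟨h1, h2⟩
    rw [if_neg]
    rintro ⟨h3, h4⟩
    have h5 : (T' \ T'').ncard = 1 := by
      rw [Set.ncard_sdiff h4, cT', hT'']; omega
    obtain ⟨k, hk⟩ := Set.ncard_eq_one.1 h5
    have hk' : T' = insert k T'' := by
      rw [Set.insert_eq, ← hk, Set.sdiff_union_of_subset h4]
    have hkT : k ∈ T' \ T'' := by rw [hk]; rfl
    have hkm := (hTe k).1 (h3 hkT.1)
    rcases hkm with h6 | rfl | rfl
    · exact hkT.2 h6
    · exact h1 (Subtype.ext hk')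
    · exact h2 (Subtype.ext hk')

theorem lift_comp_desc {J : Type w} [Fintype J] {f : J → A} {B C : A} (g : ∀ j, B ⟶ f j)
    (h : ∀ j, f j ⟶ C) : biproduct.lift g ≫ biproduct.desc h = ∑ j, g j ≫ h j := by
  have e0 : biproduct.lift g =
      biproduct.lift g ≫ ∑ j, (biproduct.bicone f).π j ≫ (biproduct.bicone f).ι j := by
    rw [IsBilimit.total (biproduct.isBilimit f)]
    exact (Category.comp_id _).symm
  rw [e0, Preadditive.comp_sum, Preadditive.sum_comp]
  refine Finset.sum_congr rfl fun j _ => ?_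
  have e1 : biproduct.lift g ≫ (biproduct.bicone f).π j = g j := biproduct.lift_π g j
  have e2 : (biproduct.bicone f).ι j ≫ biproduct.desc h = h j := biproduct.ι_desc h j
  rw [← Category.assoc, e1]
  exact (Category.assoc _ _ _).trans (congrArg (g j ≫ ·) e2)

variable [Finite S]

/-- Degree `k` of the total complex: the direct sum of the `x_T`, `#T = k`. -/
abbrev totObj (x : Cube S A) (k : ℕ) : A :=
  ⨁ fun T : {T : Set S // T.ncard = k} => x.obj (op T.1)

/-- The differential of the total complex, with components `totComp`. -/
def totD (x : Cube S A) (i j : ℕ) : totObj x i ⟶ totObj x j :=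
  if j + 1 = i then biproduct.desc fun T => biproduct.lift fun T' => totComp x T.1 T'.1 else 0

theorem totD_comp (x : Cube S A) (n : ℕ) : totD x (n + 2) (n + 1) ≫ totD x (n + 1) n = 0 := by
  classical
  have := Fintype.ofFinite {T : Set S // T.ncard = n + 1}
  apply biproduct.hom_ext'
  intro T
  apply biproduct.hom_ext
  intro T''
  simp only [totD, if_true, biproduct.ι_desc_assoc, Category.assoc, comp_zero, zero_comp]
  rw [← Category.assoc, lift_comp_desc, Preadditive.sum_comp]
  simp only [Category.assoc, biproduct.lift_π]
  by_cases h : T''.1 ⊆ T.1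
  · have e : ∀ T' : {T : Set S // T.ncard = n + 1}, totComp x T.1 T'.1 ≫ totComp x T'.1 T''.1 =
        (if T'.1 ⊆ T.1 ∧ T''.1 ⊆ T'.1 then totSign T.1 T'.1 * totSign T'.1 T''.1 else 0) •
          x.map (homOfLE (show T''.1 ≤ T.1 from h)).op := by
      intro T'
      unfold totComp
      by_cases h1 : T'.1 ≤ T.1
      · by_cases h2 : T''.1 ≤ T'.1
        · rw [dif_pos h1, dif_pos h2, if_pos ⟨h1, h2⟩, Preadditive.zsmul_comp,
            Preadditive.comp_zsmul, smul_smul, ← x.map_comp]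
          rfl
        · rw [dif_neg h2, if_neg (fun h3 => h2 h3.2), comp_zero, zero_smul]
      · rw [dif_neg h1, if_neg (fun h3 => h1 h3.1), zero_comp, zero_smul]
    rw [Finset.sum_congr rfl fun T' _ => e T', ← Finset.sum_smul,
      sum_totSign T.1 T''.1 n T.2 T''.2 h, zero_smul]
  · refine Finset.sum_eq_zero fun T' _ => ?_
    unfold totComp
    by_cases h1 : T'.1 ≤ T.1
    · by_cases h2 : T''.1 ≤ T'.1
      · exact absurd (h2.trans h1) h
      · rw [dif_neg h2, comp_zero]
    · rw [dif_neg h1, zero_comp]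

/-- The total complex of an `S`-cube. The linear order on the finite set `S` amounts to the choice
of a bijection of `S` with `{1, …, n}`, which is needed for the signs. -/
def tot (x : Cube S A) : ChainComplex A ℕ where
  X := totObj x
  d := totD x
  shape i j h := if_neg h
  d_comp_d' i j k hij hjk := by
    obtain rfl : j + 1 = i := hij
    obtain rfl : k + 1 = j := hjk
    exact totD_comp x k

/-- The chain map of total complexes induced by a morphism of `S`-cubes. -/
def totMap {x y : Cube S A} (φ : x ⟶ y) : tot x ⟶ tot y where
  f k := biproduct.map fun T => φ.app (op T.1)
  comm' i j h := by
    obtain rfl : j + 1 = i := h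
    apply biproduct.hom_ext'
    intro T
    apply biproduct.hom_ext
    intro T'
    simp only [tot, totD, if_true, biproduct.ι_map_assoc, biproduct.ι_desc_assoc, Category.assoc,
      biproduct.lift_π, biproduct.map_π, biproduct.lift_π_assoc]
    unfold totComp
    split_ifs with h1
    · rw [Preadditive.comp_zsmul, Preadditive.zsmul_comp, φ.naturality]
    · rw [comp_zero, zero_comp]

end Tot

section Homology

variable {A : Type u} [Category.{v} A] [Abelian A]

attribute [local instance] Abelian.hasFiniteBiproducts

/-- The morphism `H₀ Tot x ⟶ H₀ Tot y` induced by a morphism `x ⟶ y` of `S`-cubes. -/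
def homologyZeroTot {S : Type w} [LinearOrder S] [Finite S] {x y : Cube S A} (φ : x ⟶ y) :
    (tot x).homology 0 ⟶ (tot y).homology 0 :=
  HomologicalComplex.homologyMap (totMap φ) 0

end Homology

section Families

variable {S : Type w}

open Classical in
/-- The index in `[2] ^ S` of the source of the `t`-th morphism, `t ∈ U ⊔ {s}`: it is
`((W ∪ {s}) ∖ V', V')` for `t = s` and `(W ∖ (V ∪ {t}), V ∪ {t})` for `t ∈ U`, with
`V' = V ∖ {v}`. -/
def famIndex (W V : Set S) (s v t : S) : Pow S (Fin 3) :=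
  if t = s then chi ((W ∪ {s}) \ (V \ {v})) (V \ {v}) else chi (W \ (V ∪ {t})) (V ∪ {t})

theorem le_famIndex (W V : Set S) (s v t : S) :
    chi (W \ (V \ {v})) (V \ {v}) ≤ famIndex W V s v t := by
  unfold famIndex
  split_ifs with h
  · apply chi_le_chi le_rfl
    intro r hr
    exact Or.inl ⟨Or.inl hr.1, hr.2⟩
  · apply chi_le_chi
    · exact fun r hr => Or.inl hr.1
    · intro r hr
      by_cases h1 : r ∈ V ∪ {t}
      · exact Or.inr h1
      · exact Or.inl ⟨hr.1, h1⟩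

/-- The family, indexed by `U ⊔ {s}`, of the morphisms
`x_{W ∖ (V ∪ {k}), V ∪ {k}} ⟶ x_{W ∖ V', V'}` for `k ∈ U`, and
`x_{(W ∪ {s}) ∖ V', V'} ⟶ x_{W ∖ V', V'}` for `s`, with `V' = V ∖ {v}`. -/
def fam {A : Type u} [Category.{v} A] (x : DCube S A) (W U V : Set S) (s v : S)
    (t : (insert s U : Set S)) :
    x.obj (op (famIndex W V s v t)) ⟶ x.obj (op (chi (W \ (V \ {v})) (V \ {v}))) :=
  x.map (homOfLE (le_famIndex W V s v t)).op

end Families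

end Cubes

end

/-! As `x` is monic, its vertices behave like subobjects of the vertex at `chi ∅ ∅`. Sums of such
subobjects are handled by `InSpan`, which tests membership by morphisms out of the vertex, and
intersections by `Fac`, both applied to generalized elements `f : R ⟶ _`.

For finite non-empty `S`, a cube $y$ is admissible exactly when all morphisms $y_T/\sum_{k\in
K}y_{T\cup\{k\}}\to y_{T'}/\sum_{k\in K}y_{T'\cup\{k\}}$, $T'\subseteq T$, are monic
(`QuotientsMonic`): passing to $H_0^k$ amounts to adding $k$ to $K$.

Write $x(U,V)$ for the vertex at `chi U V`; then $e_S^*x$ has vertices $x(S,T)$. Let $f$ lie in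
$x(S,T)$ and in $\sum_{k\in K}x(S,T'\cup\{k\})$. The sum is contained in $\sum_k
x(\emptyset,T'\cup\{k\})$, so admissibility of $\mathbf 2^*x$ puts $f$ in $\sum_k
x(\emptyset,T\cup\{k\})$. What remains is a distributive law: such an $f$ lies in $\sum_k
x(S,T\cup\{k\})$ (`quotientsMonic_eMap_univ` makes this reduction).

The law is proved by enlarging a set $W$ from $\emptyset$ to $S$, one $s$ at a time:
$x(\{s\},\emptyset)\cap\sum_k x(W,V\cup\{k\})\subseteq\sum_k x(W\cup\{s\},V\cup\{k\})$. For $s\notin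
W\cup U\cup V$, with $k$ running over $U$, this is condition 4 (`InSpan.insert_of_mono`), because
$H_0\operatorname{Tot}$ of a cube is its vertex at $\emptyset$ modulo the images of the others. The
fibre products in condition 4 are identified by `fac_chi`, which computes vertices of $x$ as
intersections. The other positions of $s$ are elementary (`InSpan.insert_of_disjoint`). -/

namespace Cubes

/-! ### Sums and intersections of vertices, for generalized elements. -/

section Span

variable {A : Type u} [Category.{v} A]

/-- The morphism `f` to the vertex at `i` is locally a sum of morphisms that factor through
vertices at indices `j ∈ J` above `i`. -/
def InSpan [HasZeroMorphisms A] {I : Type*} [Preorder I] (y : Iᵒᵖ ⥤ A) (J : Set I) (i : I) {R : A}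
    (f : R ⟶ y.obj (op i)) : Prop :=
  ∀ ⦃Z : A⦄ (q : y.obj (op i) ⟶ Z),
    (∀ j ∈ J, ∀ h : i ≤ j, y.map (homOfLE h).op ≫ q = 0) → f ≫ q = 0

/-- The morphism `f` to the vertex at `i` factors through the vertex at `j`. -/
def Fac {I : Type*} [Preorder I] (y : Iᵒᵖ ⥤ A) {i : I} (j : I) {R : A}
    (f : R ⟶ y.obj (op i)) : Prop :=
  ∃ (h : i ≤ j) (g : R ⟶ y.obj (op j)), g ≫ y.map (homOfLE h).op = f

variable {I : Type*} [Preorder I] {y : Iᵒᵖ ⥤ A} {i j : I} {R R' : A}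

theorem map_trans {i j k : I} (h : i ≤ j) (h' : j ≤ k) :
    y.map (homOfLE h').op ≫ y.map (homOfLE h).op = y.map (homOfLE (h.trans h')).op := by
  rw [← y.map_comp]; rfl

theorem map_trans_assoc {i j k : I} (h : i ≤ j) (h' : j ≤ k) {Z : A} (q : y.obj (op i) ⟶ Z) :
    y.map (homOfLE h').op ≫ y.map (homOfLE h).op ≫ q = y.map (homOfLE (h.trans h')).op ≫ q := by
  rw [← Category.assoc, map_trans]

theorem Fac.of_le {f : R ⟶ y.obj (op i)} (hf : Fac y j f) {k : I} (hi : i ≤ k) (hk : k ≤ j) :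
    Fac y k f := by
  obtain ⟨h, g, rfl⟩ := hf
  exact ⟨hi, g ≫ y.map (homOfLE hk).op, by rw [Category.assoc, map_trans]⟩

theorem Fac.comp {f : R ⟶ y.obj (op i)} (hf : Fac y j f) (p : R' ⟶ R) : Fac y j (p ≫ f) := by
  obtain ⟨h, g, rfl⟩ := hf
  exact ⟨h, p ≫ g, by rw [Category.assoc]⟩

theorem fac_map (h : i ≤ j) : Fac y j (y.map (homOfLE h).op) := ⟨h, 𝟙 _, by simp⟩

theorem Fac.sub [Preadditive A] {f g : R ⟶ y.obj (op i)} (hf : Fac y j f) (hg : Fac y j g) :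
    Fac y j (f - g) := by
  obtain ⟨h, a, rfl⟩ := hf
  obtain ⟨-, b, rfl⟩ := hg
  exact ⟨h, a - b, by rw [Preadditive.sub_comp]⟩

section

variable [HasZeroMorphisms A] {J J' : Set I}

theorem InSpan.comp {f : R ⟶ y.obj (op i)} (hf : InSpan y J i f) (p : R' ⟶ R) :
    InSpan y J i (p ≫ f) := by
  intro Z q hq
  rw [Category.assoc, hf q hq, comp_zero]

theorem InSpan.of_epi {f : R ⟶ y.obj (op i)} (p : R' ⟶ R) [Epi p]
    (hf : InSpan y J i (p ≫ f)) : InSpan y J i f := by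
  intro Z q hq
  rw [← cancel_epi p, ← Category.assoc, hf q hq, comp_zero]

theorem InSpan.mono {f : R ⟶ y.obj (op i)} (hf : InSpan y J i f)
    (h : ∀ j ∈ J, i ≤ j → ∃ k ∈ J', i ≤ k ∧ k ≤ j) : InSpan y J' i f := by
  intro Z q hq
  refine hf q fun j hj hij => ?_
  obtain ⟨k, hk, hik, hkj⟩ := h j hj hij
  rw [← map_trans_assoc hik hkj, hq k hk hik, comp_zero]

theorem Fac.inSpan {f : R ⟶ y.obj (op i)} (hf : Fac y j f) (hj : j ∈ J) : InSpan y J i f := by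
  obtain ⟨h, g, rfl⟩ := hf
  intro Z q hq
  rw [Category.assoc, hq j hj h, comp_zero]

theorem InSpan.map {f : R ⟶ y.obj (op j)} (hf : InSpan y J j f) (h : i ≤ j) :
    InSpan y J i (f ≫ y.map (homOfLE h).op) := by
  intro Z q hq
  rw [Category.assoc]
  refine hf _ fun k hk hjk => ?_
  rw [map_trans_assoc, hq k hk]

end

theorem InSpan.add [Preadditive A] {J : Set I} {f g : R ⟶ y.obj (op i)} (hf : InSpan y J i f)
    (hg : InSpan y J i g) : InSpan y J i (f + g) := by
  intro Z q hq
  rw [Preadditive.add_comp, hf q hq, hg q hq, add_zero]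

variable [Abelian A] {J : Set I}

/-- A test morphism on the vertex at `j` extends to the vertex at `i` by pushing out. The pushout of
a monomorphism is a monomorphism, so nothing is lost by testing after the extension. -/
theorem InSpan.of_map (h : i ≤ j) [Mono (y.map (homOfLE h).op)] (hJ : ∀ k ∈ J, i ≤ k → j ≤ k)
    {f : R ⟶ y.obj (op j)} (hf : InSpan y J i (f ≫ y.map (homOfLE h).op)) : InSpan y J j f := by
  intro Z q hq
  rw [← cancel_mono (pushout.inr (y.map (homOfLE h).op) q), Category.assoc, zero_comp,
    ← pushout.condition, ← Category.assoc]
  refine hf _ fun k hk hik => ?_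
  rw [← map_trans_assoc h (hJ k hk hik), pushout.condition, ← Category.assoc,
    hq k hk (hJ k hk hik), zero_comp]

theorem InSpan.fac (h : i ≤ j) [Mono (y.map (homOfLE h).op)] (hJ : ∀ k ∈ J, i ≤ k → j ≤ k)
    {f : R ⟶ y.obj (op i)} (hf : InSpan y J i f) : Fac y j f := by
  have h0 : f ≫ cokernel.π (y.map (homOfLE h).op) = 0 := by
    refine hf _ fun k hk hik => ?_
    rw [← map_trans_assoc h (hJ k hk hik), cokernel.condition, comp_zero]
  exact ⟨h, Abelian.monoLift _ f h0, Abelian.monoLift_comp _ _ h0⟩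

/-- The quotient by the span is a universal test morphism. It turns membership in a span into a
single equation; finiteness of `I` provides the coproduct whose image is the span. -/
theorem exists_quotient [Finite I] (y : Iᵒᵖ ⥤ A) (J : Set I) (i : I) :
    ∃ (Q : A) (c : y.obj (op i) ⟶ Q),
      (∀ k ∈ J, ∀ h : i ≤ k, y.map (homOfLE h).op ≫ c = 0) ∧
      ∀ ⦃Z : A⦄ (q : y.obj (op i) ⟶ Z),
        (∀ k ∈ J, ∀ h : i ≤ k, y.map (homOfLE h).op ≫ q = 0) → ∃ q', c ≫ q' = q := by
  let K : Set I := {k | k ∈ J ∧ i ≤ k}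
  let D : (∐ fun k : K => y.obj (op k.1)) ⟶ y.obj (op i) :=
    Sigma.desc fun k : K => y.map (homOfLE k.2.2).op
  refine ⟨cokernel D, cokernel.π D, fun k hk h => ?_, fun Z q hq => ?_⟩
  · have : y.map (homOfLE h).op = Sigma.ι (fun k : K => y.obj (op k.1)) ⟨k, hk, h⟩ ≫ D := by
      simp [D]
    rw [this, Category.assoc, cokernel.condition, comp_zero]
  · refine ⟨cokernel.desc D q ?_, cokernel.π_desc _ _ _⟩
    apply Sigma.hom_ext
    intro k
    simpa [D] using hq k.1 k.2.1 k.2.2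

theorem exists_epi_comp_eq {X Q : A} (d : X ⟶ Q) (f : R ⟶ Q) 
    (h : ∀ ⦃Z : A⦄ (q : Q ⟶ Z), d ≫ q = 0 → f ≫ q = 0) :
    ∃ (R' : A) (p : R' ⟶ R) (_ : Epi p) (a : R' ⟶ X), p ≫ f = a ≫ d :=
  (ShortComplex.exact_iff_exact_up_to_refinements _).1 (ShortComplex.exact_cokernel d) f
    (h _ (cokernel.condition d))

/-- Up to an epimorphic cover, an element of the sum of the span of `J` and the image of the
vertex at `j` is the sum of an element of each. -/
theorem InSpan.exists_sub [Finite I] (h : i ≤ j) {f : R ⟶ y.obj (op i)}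
    (hf : InSpan y (insert j J) i f) :
    ∃ (R' : A) (p : R' ⟶ R) (_ : Epi p) (a : R' ⟶ y.obj (op j)),
      InSpan y J i (p ≫ f - a ≫ y.map (homOfLE h).op) := by
  obtain ⟨Q, c, hc, hc'⟩ := exists_quotient y J i
  obtain ⟨R', p, hp, a, ha⟩ := exists_epi_comp_eq (y.map (homOfLE h).op ≫ c) (f ≫ c) (by
    intro Z q hq
    rw [Category.assoc] at hq ⊢
    apply hf
    intro k hk hik
    rcases hk with rfl | hk
    · exact hq
    · rw [← Category.assoc, hc k hk hik, zero_comp])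
  refine ⟨R', p, hp, a, fun Z q hq => ?_⟩
  obtain ⟨q, rfl⟩ := hc' q hq
  rw [← Category.assoc, Preadditive.sub_comp, Category.assoc, Category.assoc, ha, sub_self,
    zero_comp]

end Span

/-! ### Admissibility as monicity of quotients. -/

section Admissible

variable {A : Type u} [Category.{v} A] [Abelian A] {S : Type w}

/-- The subsets of `S` that meet `K`. -/
def meeting (K : Set S) : Set (Set S) := {U | (U ∩ K).Nonempty}

/-- For all `T' ⊆ T` and all `K`, the morphism from the quotient of the vertex at `T` by the images
of the vertices at the `T ∪ {k}`, `k ∈ K`, to the same quotient for `T'` is a monomorphism. -/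
def QuotientsMonic (y : Cube S A) : Prop :=
  ∀ (K T T' : Set S) (h : T' ≤ T) ⦃R : A⦄ (f : R ⟶ y.obj (op T)),
    InSpan y (meeting K) T' (f ≫ y.map (homOfLE h).op) → InSpan y (meeting K) T f

theorem QuotientsMonic.isMonic {y : Cube S A} (hy : QuotientsMonic y) : IsMonic y := by
  intro T' T h
  apply Preadditive.mono_of_cancel_zero
  intro R f hf
  have := hy ∅ T T' h f (by
    intro Z q _
    rw [hf, zero_comp]) (𝟙 _) (by
    rintro U ⟨k, -, hk⟩
    exact hk.elim)
  simpa using this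

/-- The case `K = {t}` over `∅ ⊆ T` says that the vertices at `T` and `{t}` intersect in the vertex
at `insert t T`. -/
theorem QuotientsMonic.fac {y : Cube S A} (hy : QuotientsMonic y) {T : Set S} (hT : T.Finite)
    {R : A} (f : R ⟶ y.obj (op ∅)) (hf : ∀ t ∈ T, Fac y {t} f) : Fac y T f := by
  induction T, hT using Set.Finite.induction_on with
  | empty => exact ⟨le_rfl, f, by simp⟩
  | @insert t T _ _ ih =>
    obtain ⟨h, g, rfl⟩ := ih fun s hs => hf s (Set.mem_insert_of_mem _ hs)
    have h1 : InSpan y (meeting {t}) T g := by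
      apply hy _ _ _ h
      exact (hf t (Set.mem_insert _ _)).inSpan ⟨t, rfl, rfl⟩
    have := hy.isMonic (Set.subset_insert t T)
    obtain ⟨h2, g', rfl⟩ := h1.fac (Set.subset_insert t T) (by
      rintro U ⟨t', ht, rfl⟩ hU
      exact Set.insert_subset ht hU)
    exact ⟨h.trans h2, g', by rw [Category.assoc, map_trans]⟩

/-- The projection from the vertex at `T` to that of the homology in direction `k`. -/
noncomputable def toDirHomology (k : S) (y : Cube S A) (T : Set {t : S // t ≠ k}) :
    y.obj (op (faceMap k ∅ T)) ⟶ (dirHomology k y).obj (op T) :=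
  cokernel.π ((boundary k y).app (op T))

instance (k : S) (y : Cube S A) (T : Set {t : S // t ≠ k}) : Epi (toDirHomology k y T) :=
  inferInstanceAs (Epi (cokernel.π ((boundary k y).app (op T))))

theorem exists_toDirHomology_comp (k : S) (y : Cube S A) (T : Set {t : S // t ≠ k}) {Z : A}
    (q : y.obj (op (faceMap k ∅ T)) ⟶ Z) (hq : y.map (homOfLE (faceMap_le k T)).op ≫ q = 0) :
    ∃ q', toDirHomology k y T ≫ q' = q :=
  ⟨cokernel.desc ((boundary k y).app (op T)) q hq, cokernel.π_desc _ _ _⟩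

theorem toDirHomology_map (k : S) (y : Cube S A) {T T' : Set {t : S // t ≠ k}} (h : T' ≤ T) :
    toDirHomology k y T ≫ (dirHomology k y).map (homOfLE h).op =
      y.map (homOfLE ((faceMap k ∅).monotone h)).op ≫ toDirHomology k y T' :=
  cokernel.π_desc _ _ _

/-- Dividing by direction `k` and then by `K` is dividing by `insert k K` at once. This carries both
implications between `QuotientsMonic` for a cube and for its homology cubes. -/
theorem inSpan_toDirHomology {k : S} {y : Cube S A} {K T : Set {t : S // t ≠ k}} {R : A}
    (f : R ⟶ y.obj (op (faceMap k ∅ T))) :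
    InSpan (dirHomology k y) (meeting K) T (f ≫ toDirHomology k y T) ↔
      InSpan y (meeting (insert k (Subtype.val '' K))) (faceMap k ∅ T) f := by
  constructor
  · intro hf Z q hq
    obtain ⟨q, rfl⟩ := exists_toDirHomology_comp k y T q
      (hq (faceMap k {k} T) ⟨k, Or.inr rfl, Or.inl rfl⟩ (faceMap_le k T))
    rw [← Category.assoc]
    apply hf
    rintro U ⟨t, htU, htK⟩ h
    rw [← cancel_epi (toDirHomology k y U), ← Category.assoc, toDirHomology_map, Category.assoc,
      comp_zero]
    exact hq _ ⟨t.1, Or.inl ⟨t, htU, rfl⟩, Or.inr ⟨t, htK, rfl⟩⟩ _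
  · intro hf Z q hq
    rw [Category.assoc]
    apply hf
    rintro U ⟨t, htU, (rfl | ⟨t, htK, rfl⟩)⟩ h
    · have h1 : faceMap t {t} T ≤ U :=
        Set.union_subset (Set.subset_union_left.trans h) (Set.singleton_subset_iff.2 htU)
      rw [← map_trans_assoc (faceMap_le t T) h1]
      have : y.map (homOfLE (faceMap_le t T)).op ≫ toDirHomology t y T = 0 :=
        cokernel.condition ((boundary t y).app (op T))
      rw [← Category.assoc (y.map (homOfLE (faceMap_le t T)).op), this, zero_comp, comp_zero]
    · have h1 : T ≤ insert t T := Set.subset_insert _ _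
      have h2 : faceMap k ∅ (insert t T) ≤ U := by
        rintro s (⟨s, (rfl | hs), rfl⟩ | hs)
        · exact htU
        · exact h (Or.inl ⟨s, hs, rfl⟩)
        · exact hs.elim
      rw [← map_trans_assoc ((faceMap k ∅).monotone h1) h2,
        ← Category.assoc (y.map (homOfLE ((faceMap k ∅).monotone h1)).op), ← toDirHomology_map k y h1,
        Category.assoc, hq _ ⟨t, Set.mem_insert _ _, htK⟩ h1, comp_zero, comp_zero]

theorem quotientsMonic_dirHomology {k : S} {y : Cube S A} (hy : QuotientsMonic y) :
    QuotientsMonic (dirHomology k y) := by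
  intro K T T' h R f hf
  -- `f` need not lift along the cokernel projection, but it does after the epimorphism `p`.
  let p : Limits.pullback f (toDirHomology k y T) ⟶ R := pullback.fst _ _
  have : Epi p := inferInstanceAs (Epi (pullback.fst _ _))
  apply InSpan.of_epi p
  have e : p ≫ f = pullback.snd _ _ ≫ toDirHomology k y T := pullback.condition
  rw [e, inSpan_toDirHomology]
  apply hy _ _ _ ((faceMap k ∅).monotone h)
  rw [← inSpan_toDirHomology, Category.assoc, ← toDirHomology_map, ← Category.assoc, ← e,
    Category.assoc]
  exact hf.comp p

theorem exists_faceMap_eq {k : S} {T : Set S} (hT : k ∉ T) :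
    ∃ T₀ : Set {t : S // t ≠ k}, T = faceMap k ∅ T₀ := by
  refine ⟨Subtype.val ⁻¹' T, ?_⟩
  ext s
  constructor
  · intro hs
    exact Or.inl ⟨⟨s, fun h => hT (h ▸ hs)⟩, hs, rfl⟩
  · rintro (⟨s, hs, rfl⟩ | hs)
    · exact hs
    · exact hs.elim

/-- For `K = ∅` this is monicity. Otherwise some `k ∈ K` is divided out first; if `k ∈ T` the
quotient at `T` is already zero. -/
theorem quotientsMonic_of_dirHomology {y : Cube S A} (hm : IsMonic y)
    (hy : ∀ k, QuotientsMonic (dirHomology k y)) : QuotientsMonic y := by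
  intro K T T' h R f hf
  rcases K.eq_empty_or_nonempty with rfl | ⟨k, hk⟩
  · have h0 := hf (𝟙 _) (by
      rintro U ⟨k, -, hk⟩
      exact hk.elim)
    have := hm h
    rw [Category.comp_id, ← zero_comp, cancel_mono] at h0
    intro Z q _
    rw [h0, zero_comp]
  by_cases hkT : k ∈ T
  · exact Fac.inSpan (j := T) ⟨le_rfl, f, by simp⟩ ⟨k, hkT, hk⟩
  obtain ⟨T, rfl⟩ := exists_faceMap_eq hkT
  obtain ⟨T', rfl⟩ := exists_faceMap_eq (fun h' => hkT (h h'))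
  have h' : T' ≤ T := by
    intro t ht
    rcases h (Or.inl ⟨t, ht, rfl⟩) with ⟨t', ht', e⟩ | h0
    · exact Subtype.ext e ▸ ht'
    · exact h0.elim
  have hK : K = insert k (Subtype.val '' (Subtype.val ⁻¹' K : Set {t : S // t ≠ k})) := by
    ext s
    by_cases hs : s = k
    · simp [hs, hk]
    · simp [hs]
  rw [hK, ← inSpan_toDirHomology] at hf ⊢
  apply hy k _ _ _ h'
  rw [Category.assoc, toDirHomology_map, ← Category.assoc]
  exact hf

theorem quotientsMonic_of_subsingleton [Subsingleton S] {y : Cube S A} (hm : IsMonic y) :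
    QuotientsMonic y := by
  refine quotientsMonic_of_dirHomology hm fun k K T T' h R f hf => ?_
  have hS : ∀ t : {t : S // t ≠ k}, False := fun t => t.2 (Subsingleton.elim _ _)
  obtain rfl : T = T' := by ext t; exact (hS t).elim
  have : (homOfLE h).op = 𝟙 (op T) := rfl
  rwa [this, (dirHomology k y).map_id, Category.comp_id] at hf

theorem IsAdmissible.quotientsMonic {y : Cube S A} (hy : IsAdmissible y) : QuotientsMonic y := by
  induction hy with
  | one y hS hm =>
    have := (Nat.card_eq_one_iff_unique.1 hS).1
    exact quotientsMonic_of_subsingleton hm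
  | step y hS hm _ ih => exact quotientsMonic_of_dirHomology hm ih

theorem QuotientsMonic.isAdmissible [Finite S] [Nonempty S] {y : Cube S A}
    (hy : QuotientsMonic y) : IsAdmissible y := by
  obtain ⟨n, hn⟩ : ∃ n, Nat.card S = n + 1 := ⟨Nat.card S - 1, by
    have := Nat.card_pos (α := S)
    omega⟩
  induction n generalizing S with
  | zero => exact .one y hn hy.isMonic
  | succ n ih =>
    refine .step y (by omega) hy.isMonic fun k => ?_
    have hc : Nat.card {t : S // t ≠ k} = n + 1 := by
      have := Set.ncard_add_ncard_compl ({k} : Set S)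
      rw [Set.ncard_singleton, hn] at this
      have h2 : ({k}ᶜ : Set S).ncard = Nat.card {t : S // t ≠ k} := rfl
      omega
    have : Nonempty {t : S // t ≠ k} := (Nat.card_pos_iff.1 (by omega)).1
    exact ih (quotientsMonic_dirHomology hy) hc

end Admissible

/-! ### $H_0$ of the total complex as a quotient of the vertex at `∅`. -/

section Homology

variable {A : Type u} [Category.{v} A] [Abelian A] {S : Type w} [Finite S]

attribute [local instance] Abelian.hasFiniteBiproducts

/-- The inclusion of the vertex at `T` in the part of degree `#T` of the total complex. -/
noncomputable def totIncl (y : Cube S A) (T : Set S) {k : ℕ} (hT : T.ncard = k) :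
    y.obj (op T) ⟶ totObj y k :=
  biproduct.ι (fun T : {T : Set S // T.ncard = k} => y.obj (op T.1)) ⟨T, hT⟩

/-- The projection of the part of degree `#T` of the total complex to the vertex at `T`. -/
noncomputable def totProj (y : Cube S A) (T : Set S) {k : ℕ} (hT : T.ncard = k) :
    totObj y k ⟶ y.obj (op T) :=
  biproduct.π (fun T : {T : Set S // T.ncard = k} => y.obj (op T.1)) ⟨T, hT⟩

theorem totIncl_totProj (y : Cube S A) (T : Set S) {k : ℕ} (hT : T.ncard = k) :
    totIncl y T hT ≫ totProj y T hT = 𝟙 _ :=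
  biproduct.ι_π_self _ _

variable [LinearOrder S]

theorem totIncl_totMap {x y : Cube S A} (φ : x ⟶ y) (T : Set S) {k : ℕ} (hT : T.ncard = k) :
    totIncl x T hT ≫ (totMap φ).f k = φ.app (op T) ≫ totIncl y T hT := by
  refine (biproduct.ι_map (fun T : {T : Set S // T.ncard = k} => φ.app (op T.1)) ⟨T, hT⟩).trans ?_
  rfl

theorem totIncl_totD_totProj (y : Cube S A) {T T' : Set S} {k : ℕ} (hT : T.ncard = k + 1)
    (hT' : T'.ncard = k) :
    totIncl y T hT ≫ totD y (k + 1) k ≫ totProj y T' hT' = totComp y T T' := by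
  rw [totIncl, totProj, totD, if_pos rfl, biproduct.ι_desc_assoc, biproduct.lift_π]

theorem totD_totProj_empty_comp (y : Cube S A) {Z : A} (q : y.obj (op ∅) ⟶ Z)
    (hq : ∀ U : Set S, U.Nonempty → y.map (homOfLE (Set.empty_subset U)).op ≫ q = 0) :
    totD y 1 0 ≫ totProj y ∅ (Set.ncard_empty S) ≫ q = 0 := by
  apply biproduct.hom_ext'
  rintro ⟨T, hT⟩
  have h := totIncl_totD_totProj y hT (Set.ncard_empty S)
  rw [comp_zero, ← Category.assoc, ← Category.assoc]
  refine (congrArg (· ≫ q) ((Category.assoc _ _ _).trans h)).trans ?_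
  rw [totComp, dif_pos (Set.empty_subset T), Preadditive.zsmul_comp, hq, smul_zero]
  exact Set.nonempty_of_ncard_ne_zero (by omega)

theorem map_comp_eq_zero_of_totD_comp (y : Cube S A) {Z : A} (p : totObj y 0 ⟶ Z)
    (hp : totD y 1 0 ≫ p = 0) {U : Set S} (hU : U.Nonempty) :
    y.map (homOfLE (Set.empty_subset U)).op ≫ totIncl y ∅ (Set.ncard_empty S) ≫ p = 0 := by
  obtain ⟨s, hs⟩ := hU
  have h1 := totIncl_totD_totProj y (Set.ncard_singleton s) (Set.ncard_empty S)
  have h2 : totProj y ∅ (Set.ncard_empty S) ≫ totIncl y ∅ (Set.ncard_empty S) = 𝟙 _ := by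
    apply biproduct.hom_ext'
    rintro ⟨T, hT⟩
    obtain rfl : T = ∅ := (Set.ncard_eq_zero T.toFinite).1 hT
    have := totIncl_totProj y ∅ (Set.ncard_empty S)
    change totIncl y ∅ hT ≫ _ = totIncl y ∅ hT ≫ _
    rw [← Category.assoc, this, Category.comp_id, Category.id_comp]
  have h3 : totComp y {s} ∅ ≫ totIncl y ∅ (Set.ncard_empty S) ≫ p = 0 := by
    rw [← h1, Category.assoc, Category.assoc, ← Category.assoc (totProj y _ _), h2,
      Category.id_comp, hp, comp_zero]
  rw [totComp, dif_pos (Set.empty_subset {s}), Preadditive.zsmul_comp] at h3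
  have h4 := congrArg (totSign {s} ∅ • ·) h3
  -- The sign squares to 1, so multiplying by it once more removes it.
  rw [smul_zero, smul_smul, totSign, ← mul_pow, neg_one_mul, neg_neg, one_pow, one_smul] at h4
  rw [← map_trans_assoc (Set.empty_subset {s}) (Set.singleton_subset_iff.2 hs)]
  exact (congrArg (_ ≫ ·) h4).trans comp_zero

theorem InSpan.of_mono_homologyZeroTot {x y : Cube S A} (φ : x ⟶ y)
    [hφ : Mono (homologyZeroTot φ)] {R : A} (f : R ⟶ x.obj (op ∅))
    (hf : InSpan y {U | U.Nonempty} ∅ (f ≫ φ.app (op ∅))) : InSpan x {U | U.Nonempty} ∅ f := by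
  have hm : Mono (HomologicalComplex.opcyclesMap (totMap φ) 0) := by
    -- No differential leaves degree 0, so $H_0$ is the object of opcycles, the cokernel of the
    -- differential from degree 1.
    have e : HomologicalComplex.opcyclesMap (totMap φ) 0 =
        inv ((tot x).homologyι 0) ≫ homologyZeroTot φ ≫ (tot y).homologyι 0 := by
      rw [homologyZeroTot, HomologicalComplex.homologyι_naturality, IsIso.inv_hom_id_assoc]
    rw [e]
    infer_instance
  let i (z : Cube S A) : z.obj (op ∅) ⟶ (tot z).X 0 := totIncl z ∅ (Set.ncard_empty S)
  let r (z : Cube S A) : (tot z).X 0 ⟶ z.obj (op ∅) := totProj z ∅ (Set.ncard_empty S)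
  have hφ : i x ≫ (totMap φ).f 0 = φ.app (op ∅) ≫ i y := totIncl_totMap φ _ _
  have h1 : (f ≫ φ.app (op ∅)) ≫ i y ≫ (tot y).pOpcycles 0 = 0 :=
    hf _ fun U hU _ => map_comp_eq_zero_of_totD_comp y _ ((tot y).d_pOpcycles 1 0) hU
  have h2 : f ≫ i x ≫ (tot x).pOpcycles 0 = 0 := by
    rw [← cancel_mono (HomologicalComplex.opcyclesMap (totMap φ) 0), zero_comp, Category.assoc,
      Category.assoc, HomologicalComplex.p_opcyclesMap, ← Category.assoc (i x),
      hφ, Category.assoc, ← Category.assoc, h1]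
  intro Z q hq
  have h3 : (tot x).d 1 0 ≫ r x ≫ q = 0 := totD_totProj_empty_comp x q fun U hU => hq U hU _
  have h4 := HomologicalComplex.p_descOpcycles (tot x) (r x ≫ q) 1 (by simp) h3
  have h5 : i x ≫ r x = 𝟙 _ := totIncl_totProj x ∅ _
  have h6 : i x ≫ (tot x).pOpcycles 0 ≫ (tot x).descOpcycles _ 1 (by simp) h3 = q := by
    rw [h4, ← Category.assoc, h5, Category.id_comp]
  rw [← h6, ← Category.assoc (i x), ← Category.assoc, h2, zero_comp]

end Homology

/-! ### Factorizations through fibre products. -/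

section Fibered

variable {D : Type u} [Category.{v} D] [HasFiniteLimits D] {S : Type w} [Finite S]

/-- The structure morphism of `fib f` to the base of the family `f`. -/
noncomputable def fibBase {B : D} {X : S → D} (f : ∀ s, X s ⟶ B) (T : Set S) :
    (fib f).obj (op T) ⟶ B :=
  WidePullback.base (fun s : T => f s)

theorem map_fibBase {B : D} {X : S → D} (f : ∀ s, X s ⟶ B) {T T' : Set S} (h : T' ≤ T) :
    (fib f).map (homOfLE h).op ≫ fibBase f T' = fibBase f T :=
  WidePullback.lift_base _ _ _ _

theorem exists_comp_fibBase {B : D} {X : S → D} (f : ∀ s, X s ⟶ B) (T : Set S) {R : D} (g : R ⟶ B)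
    (h : ∀ s ∈ T, ∃ a, a ≫ f s = g) : ∃ l : R ⟶ (fib f).obj (op T), l ≫ fibBase f T = g := by
  choose a ha using h
  exact ⟨WidePullback.lift g (fun s : T => a s s.2) fun s => ha s s.2,
    WidePullback.lift_base _ _ _ _⟩

theorem exists_fibBase_eq {B : D} {X : S → D} (f : ∀ s, X s ⟶ B) {T : Set S} {s : S} (hs : s ∈ T) :
    ∃ a, a ≫ f s = fibBase f T :=
  ⟨WidePullback.π (fun s : T => f s) ⟨s, hs⟩, WidePullback.π_arrow (fun s : T => f s) ⟨s, hs⟩⟩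

theorem isIso_fibBase {B : D} {X : S → D} (f : ∀ s, X s ⟶ B) {T : Set S} (hT : T = ∅) :
    IsIso (fibBase f T) := by
  subst hT
  obtain ⟨l, hl⟩ := exists_comp_fibBase f ∅ (𝟙 B) fun s hs => hs.elim
  refine ⟨l, ?_, hl⟩
  refine WidePullback.hom_ext _ _ _ (fun s => s.2.elim) ?_
  change (_ ≫ l) ≫ fibBase f ∅ = 𝟙 _ ≫ fibBase f ∅
  rw [Category.assoc, hl, Category.comp_id, Category.id_comp]

theorem IsFibered.fac {y : Cube S D} (hy : IsFibered y) {T : Set S} {R : D}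
    (f : R ⟶ y.obj (op ∅)) (hf : ∀ t ∈ T, Fac y {t} f) : Fac y T f := by
  have : IsIso (toFib y) := hy
  obtain ⟨l, hl⟩ := exists_comp_fibBase (cov y) T f fun s hs => (hf s hs).2
  refine ⟨Set.empty_subset T, l ≫ inv ((toFib y).app (op T)), ?_⟩
  have : (toFib y).app (op T) ≫ fibBase (cov y) T = y.map (homOfLE (Set.empty_subset T)).op :=
    WidePullback.lift_base _ _ _ _
  rw [← this, Category.assoc, IsIso.inv_hom_id_assoc, hl]

end Fibered

/-! ### The order on $[2]^S$ and its effect on factorizations. -/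

section Index

variable {S : Type w}

theorem chi_empty_le (i : Pow S (Fin 3)) : chi ∅ ∅ ≤ i := by
  classical
  intro s
  simp [chi]

theorem chi_union_le {U V U' V' : Set S} {i : Pow S (Fin 3)} (h : chi U V ≤ i)
    (h' : chi U' V' ≤ i) : chi (U ∪ U') (V ∪ V') ≤ i := by
  classical
  intro s
  have h1 := h s
  have h2 := h' s
  unfold chi at *
  by_cases a : s ∈ V <;> by_cases b : s ∈ V' <;> by_cases c : s ∈ U <;> by_cases d : s ∈ U' <;>
    simp_all

theorem twoMap_le {U V : Set S} : twoMap S V ≤ chi U V := by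
  classical
  intro s
  rw [twoMap_apply]
  unfold chi
  by_cases a : s ∈ V <;> simp [a]

theorem chi_le_twoMap {U V : Set S} (h : U ⊆ V) : chi U V ≤ twoMap S V := by
  classical
  intro s
  rw [twoMap_apply]
  unfold chi
  by_cases a : s ∈ V
  · simp [a]
  · have b : s ∉ U := fun b => a (h b)
    simp [a, b]

theorem eMap_eq_chi (T U : Set S) : eMap T U = chi (T ∪ U) (T ∩ U) := by
  classical
  funext s
  rw [eMap_apply]
  unfold chi
  by_cases a : s ∈ T <;> by_cases b : s ∈ U <;> simp [a, b]

end Index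

section Fac

variable {A : Type u} [Category.{v} A] {I J : Type*} [Preorder I] [Preorder J] {y : Iᵒᵖ ⥤ A}
  {i j k : I} {R : A}

theorem Fac.map {f : R ⟶ y.obj (op j)} (hf : Fac y k f) (h : i ≤ j) :
    Fac y k (f ≫ y.map (homOfLE h).op) := by
  obtain ⟨h', g, rfl⟩ := hf
  exact ⟨h.trans h', g, by rw [Category.assoc, map_trans]⟩

theorem Fac.of_map (h : i ≤ j) [Mono (y.map (homOfLE h).op)] (h' : j ≤ k)
    {f : R ⟶ y.obj (op j)} (hf : Fac y k (f ≫ y.map (homOfLE h).op)) : Fac y k f := by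
  obtain ⟨_, g, hg⟩ := hf
  refine ⟨h', g, ?_⟩
  rw [← cancel_mono (y.map (homOfLE h).op), Category.assoc, map_trans, hg]

theorem fac_pullback {φ : J →o I} {a b : J} (h : a ≤ b) (f : R ⟶ y.obj (op (φ a))) :
    Fac (pullback φ y) b f ↔ Fac y (φ b) f :=
  ⟨fun ⟨_, g, hg⟩ => ⟨φ.monotone h, g, hg⟩, fun ⟨_, g, hg⟩ => ⟨h, g, hg⟩⟩

end Fac

/-! ### Vertices of the double cube as intersections. -/

section DoubleCube

variable {A : Type u} [Category.{v} A] [Abelian A] {S : Type w} {x : DCube S A}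

/-- Restriction of the double cube to `e_T` being fibered computes the vertices in the image of
`e_T` as intersections. -/
theorem fac_eMap [Finite S] (h₂ : IsMonic x) {T : Set S} (h : IsFibered (pullback (eMap T) x))
    {R : A} (f : R ⟶ x.obj (op (chi ∅ ∅))) (U : Set S) (hT : Fac x (chi T ∅) f)
    (hU : ∀ u ∈ U, Fac x (chi (insert u T) (T ∩ {u})) f) : Fac x (chi (T ∪ U) (T ∩ U)) f := by
  have e0 : eMap T ∅ = chi T ∅ := by
    rw [eMap_eq_chi, Set.union_empty, Set.inter_empty]
  rw [← e0] at hT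
  rw [← eMap_eq_chi]
  obtain ⟨hT0, g, rfl⟩ := hT
  have := h₂ hT0
  refine Fac.map ((fac_pullback (Set.empty_subset U) g).1 (h.fac (T := U) g ?_)) hT0
  intro u hu
  rw [fac_pullback (Set.empty_subset _)]
  apply Fac.of_map hT0 ((eMap T).monotone (Set.empty_subset _))
  rw [eMap_eq_chi, Set.union_singleton]
  exact hU u hu

variable [Finite S] [Nonempty S]

theorem fac_chi_empty (h₂ : IsMonic x)
    (h₃ : ∀ T : Set S, T ≠ Set.univ → IsFibered (pullback (eMap T) x))
    {R : A} {f : R ⟶ x.obj (op (chi ∅ ∅))} {U : Set S}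
    (hU : ∀ u ∈ U, Fac x (chi {u} ∅) f) : Fac x (chi U ∅) f := by
  have := fac_eMap h₂ (h₃ ∅ Set.empty_ne_univ) f U ⟨le_rfl, f, by simp⟩ (by
    intro u hu
    rw [insert_empty_eq, Set.empty_inter]
    exact hU u hu)
  rwa [Set.empty_union, Set.empty_inter] at this

/-- The vertex at `(U, V)` is the intersection of the vertices at `({u}, ∅)` and `(∅, {v})`, for
`u ∈ U` and `v ∈ V`. -/
theorem fac_chi (h₁ : QuotientsMonic (pullback (twoMap S) x)) (h₂ : IsMonic x)
    (h₃ : ∀ T : Set S, T ≠ Set.univ → IsFibered (pullback (eMap T) x))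
    {R : A} {f : R ⟶ x.obj (op (chi ∅ ∅))} {U V : Set S}
    (hU : ∀ u ∈ U, Fac x (chi {u} ∅) f) (hV : ∀ v ∈ V, Fac x (chi ∅ {v}) f) :
    Fac x (chi U V) f := by
  have hV' : ∀ v ∈ V, Fac x (chi {v} ∅) f := fun v hv =>
    (hV v hv).of_le (chi_empty_le _) (chi_le_chi (Set.empty_subset _) Set.subset_union_right)
  by_cases hV1 : V = Set.univ
  · subst hV1
    have e0 : twoMap S ∅ ≤ chi ∅ ∅ := twoMap_le
    have := h₂ e0
    -- Fiberedness is not available for `eMap Set.univ`; here the intersection is supplied by the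
    -- admissible cube $\mathbf 2^*x$.
    have h := h₁.fac (T := Set.univ) (Set.toFinite _) (f ≫ x.map (homOfLE e0).op) (by
      intro v _
      exact (fac_pullback (Set.empty_subset _) _).2
        (((hV v trivial).of_le (chi_empty_le _) twoMap_le).map e0))
    have h' := (fac_pullback (Set.empty_subset _) _).1 h
    exact (h'.of_map e0 (chi_empty_le _)).of_le (chi_empty_le _)
      (chi_le_twoMap (Set.subset_univ _))
  -- In the cube of `eMap V`, with base `chi V ∅`, the vertex at `U ∪ V` takes the value 2 exactly
  -- on `V`. The vertices `chi V {w}`, `w ∈ V`, that this needs come from the cube of `eMap {w}`.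
  · have h := fac_eMap h₂ (h₃ V hV1) f (U ∪ V) (fac_chi_empty h₂ h₃ hV') (by
      intro w hw
      by_cases hwV : w ∈ V
      · have hw1 : ({w} : Set S) ≠ Set.univ := by
          rintro h
          exact hV1 (Set.univ_subset_iff.1 (h ▸ Set.singleton_subset_iff.2 hwV))
        have h := fac_eMap h₂ (h₃ {w} hw1) f V (hV' w hwV) (by
          intro u hu
          by_cases huw : u = w
          · subst huw
            exact (hV u hu).of_le (chi_empty_le _) (chi_le_chi Set.inter_subset_right (by simp))
          · have := fac_chi_empty h₂ h₃ (f := f) (U := {u, w}) (by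
              rintro t (rfl | rfl)
              · exact hV' t hu
              · exact hV' t hwV)
            refine this.of_le (chi_empty_le _) (chi_le_chi ?_ Set.subset_union_left)
            rintro t ⟨rfl, rfl⟩
            exact huw rfl)
        refine h.of_le (chi_empty_le _) (chi_le_chi ?_ ?_)
        · rintro t ⟨h1, rfl⟩
          exact ⟨rfl, h1⟩
        · rintro t (rfl | h1)
          · exact Or.inl (Or.inl rfl)
          · exact Or.inl (Or.inr h1)
      · have := fac_chi_empty h₂ h₃ (f := f) (U := insert w V) (by
          rintro t (rfl | h1)
          · exact hw.elim (hU t) (fun h => (hwV h).elim)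
          · exact hV' t h1)
        refine this.of_le (chi_empty_le _) (chi_le_chi ?_ Set.subset_union_left)
        rintro t ⟨h1, rfl⟩
        exact (hwV h1).elim)
    exact h.of_le (chi_empty_le _) (chi_le_chi (fun t ht => ⟨ht, Or.inr ht⟩)
      (fun t ht => Or.inl (Or.inr (Or.inl ht))))

theorem Fac.union (h₁ : QuotientsMonic (pullback (twoMap S) x)) (h₂ : IsMonic x)
    (h₃ : ∀ T : Set S, T ≠ Set.univ → IsFibered (pullback (eMap T) x))
    {R : A} {f : R ⟶ x.obj (op (chi ∅ ∅))} {U V U' V' : Set S}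
    (h : Fac x (chi U V) f) (h' : Fac x (chi U' V') f) : Fac x (chi (U ∪ U') (V ∪ V')) f := by
  apply fac_chi h₁ h₂ h₃
  · rintro u (hu | hu)
    · exact h.of_le (chi_empty_le _) (chi_le_chi (Set.empty_subset _)
        (Set.singleton_subset_iff.2 (Or.inl hu)))
    · exact h'.of_le (chi_empty_le _) (chi_le_chi (Set.empty_subset _)
        (Set.singleton_subset_iff.2 (Or.inl hu)))
  · rintro u (hu | hu)
    · exact h.of_le (chi_empty_le _) (chi_le_chi (Set.singleton_subset_iff.2 hu)
        (Set.empty_subset _))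
    · exact h'.of_le (chi_empty_le _) (chi_le_chi (Set.singleton_subset_iff.2 hu)
        (Set.empty_subset _))

end DoubleCube

/-- The spans agree because every index of `Q` above `φ a` dominates the image of some index of `P`
above `a`: larger indices contribute smaller subobjects. -/
theorem inSpan_pullback {A : Type u} [Category.{v} A] [HasZeroMorphisms A] {I J : Type*}
    [Preorder I] [Preorder J] {y : Iᵒᵖ ⥤ A} {φ : J →o I} {a : J} {P : Set J} {Q : Set I}
    (hPQ : ∀ j ∈ P, a ≤ j → φ j ∈ Q) (hQP : ∀ i ∈ Q, φ a ≤ i → ∃ j ∈ P, a ≤ j ∧ φ j ≤ i) {R : A}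
    (f : R ⟶ y.obj (op (φ a))) : InSpan (pullback φ y) P a f ↔ InSpan y Q (φ a) f := by
  constructor
  · intro hf Z q hq
    exact hf q fun j hj haj => hq (φ j) (hPQ j hj haj) (φ.monotone haj)
  · intro hf Z q hq
    change y.obj (op (φ a)) ⟶ Z at q
    refine hf q fun i hi hai => ?_
    obtain ⟨j, hj, haj, hji⟩ := hQP i hi hai
    rw [← map_trans_assoc (φ.monotone haj) hji]
    exact (congrArg (_ ≫ ·) (hq j hj haj)).trans comp_zero

/-! ### The distributive law for the double cube. -/

section DoubleCube

variable {S : Type w}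

/-- The elements of `[2] ^ S` above `χ_{W,V}` that take the value `2` somewhere on `K`. -/
def aboveMeeting (W V K : Set S) : Set (Pow S (Fin 3)) :=
  {i | chi W V ≤ i ∧ ∃ k ∈ K, chi ∅ {k} ≤ i}

theorem aboveMeeting_mono {W W' V V' K : Set S} (hW : W ⊆ W') (hV : V ⊆ V') :
    aboveMeeting W' V' K ⊆ aboveMeeting W V K := fun _ hi =>
  ⟨(chi_le_chi hV (hW.trans Set.subset_union_left)).trans hi.1, hi.2⟩

variable {A : Type u} [Category.{v} A] [Abelian A] {x : DCube S A}

/-- The hypothesis `h` is the distributive law. It is needed only for non-empty `T` disjoint from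
`K`: if `T = ∅` then `T' = T`, and if `K` meets `T` the quotient at `T` is zero. -/
theorem quotientsMonic_eMap_univ (h₁ : QuotientsMonic (pullback (twoMap S) x)) (h₂ : IsMonic x)
    (h : ∀ K T : Set S, T.Nonempty → Disjoint K T → ∀ ⦃R : A⦄ (f : R ⟶ x.obj (op (chi ∅ ∅))),
      (∀ s, Fac x (chi {s} ∅) f) → InSpan x (aboveMeeting ∅ T K) (chi ∅ ∅) f →
        InSpan x (aboveMeeting Set.univ T K) (chi ∅ ∅) f) :
    QuotientsMonic (pullback (eMap (Set.univ : Set S)) x) := by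
  intro K T T' hT R f hf
  rcases T.eq_empty_or_nonempty with rfl | hTn
  · obtain rfl : T' = ∅ := Set.subset_empty_iff.1 hT
    have : (homOfLE hT).op = 𝟙 (op (∅ : Set S)) := rfl
    rwa [this, (pullback _ x).map_id, Category.comp_id] at hf
  by_cases hKT : Disjoint K T
  swap
  · obtain ⟨k, hk, hkT⟩ := Set.not_disjoint_iff.1 hKT
    exact Fac.inSpan (j := T) ⟨le_rfl, f, by simp⟩ ⟨k, hkT, hk⟩
  change R ⟶ x.obj (op (eMap Set.univ T)) at f
  have eE : ∀ T : Set S, eMap Set.univ T = chi Set.univ T := fun T => by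
    rw [eMap_eq_chi, Set.univ_union, Set.univ_inter]
  have hE : ∀ (T : Set S) {R : A} (f : R ⟶ x.obj (op (eMap Set.univ T))),
      InSpan (pullback (eMap Set.univ) x) (meeting K) T f ↔
        InSpan x (aboveMeeting Set.univ T K) (eMap Set.univ T) f := fun T R f => by
    refine inSpan_pullback ?_ ?_ f
    · rintro U ⟨k, hkU, hkK⟩ hTU
      rw [eE]
      exact ⟨chi_le_chi hTU Set.subset_union_left, k, hkK,
        chi_le_chi (Set.singleton_subset_iff.2 hkU) (Set.empty_subset _)⟩
    · rintro j ⟨hj, k, hk, hkj⟩ -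
      refine ⟨T ∪ {k}, ⟨k, Or.inr rfl, hk⟩, Set.subset_union_left, ?_⟩
      rw [eE, ← Set.union_empty Set.univ]
      exact chi_union_le hj hkj
  have hD : ∀ (T : Set S) {R : A} (f : R ⟶ x.obj (op (twoMap S T))),
      InSpan (pullback (twoMap S) x) (meeting K) T f ↔
        InSpan x (aboveMeeting ∅ T K) (twoMap S T) f := fun T R f => by
    refine inSpan_pullback ?_ ?_ f
    · rintro U ⟨k, hkU, hkK⟩ hTU
      have hU := chi_le_twoMap (Set.empty_subset U)
      exact ⟨(chi_le_chi hTU Set.subset_union_left).trans hU, k, hkK,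
        (chi_le_chi (Set.singleton_subset_iff.2 hkU) (Set.empty_subset _)).trans hU⟩
    · rintro j ⟨hj, k, hk, hkj⟩ -
      exact ⟨T ∪ {k}, ⟨k, Or.inr rfl, hk⟩, Set.subset_union_left,
        twoMap_le.trans (chi_union_le hj hkj)⟩
  have hDE : ∀ T : Set S, twoMap S T ≤ eMap Set.univ T := fun T => by rw [eE]; exact twoMap_le
  have m₁ := h₂ (chi_empty_le (eMap Set.univ T))
  have m₂ := h₂ (chi_empty_le (twoMap S T'))
  have hTT' := (twoMap S).monotone hT
  have hTE := (eMap (Set.univ : Set S)).monotone hT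
  -- `g` is `f` seen in the vertex of $\mathbf 2^*x$ at `T`, where `h₁` applies; the comparisons
  -- below take place in the vertex at `chi ∅ ∅`.
  let g := f ≫ x.map (homOfLE (hDE T)).op
  have hg : g ≫ x.map (homOfLE (chi_empty_le (twoMap S T))).op =
      f ≫ x.map (homOfLE (chi_empty_le (eMap Set.univ T))).op := by
    rw [Category.assoc, map_trans]
  have s1 : InSpan x (aboveMeeting Set.univ T' K) (eMap Set.univ T')
      (f ≫ x.map (homOfLE hTE).op) := (hE T' _).1 hf
  have s2 := (s1.map (chi_empty_le _)).mono (J' := aboveMeeting ∅ T' K) fun j hj h =>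
    ⟨j, aboveMeeting_mono (Set.empty_subset _) le_rfl hj, h, le_rfl⟩
  have s3 : InSpan x (aboveMeeting ∅ T' K) (twoMap S T') (g ≫ x.map (homOfLE hTT').op) := by
    apply InSpan.of_map (chi_empty_le _)
      fun j hj _ => (twoMap_le (U := (∅ : Set S))).trans hj.1
    rw [Category.assoc, map_trans, hg]
    rwa [Category.assoc, map_trans] at s2
  have s4 := (hD T g).1 (h₁ K T T' hT g ((hD T' _).2 s3))
  have s5 := s4.map (chi_empty_le _)
  rw [hg] at s5
  refine (hE T f).2 ?_
  apply InSpan.of_map (chi_empty_le _) fun j hj _ => (eE T).trans_le hj.1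
  refine h K T hTn hKT _ (fun s => ?_) s5
  refine ((fac_map (chi_empty_le (eMap Set.univ T))).comp f).of_le (chi_empty_le _) ?_
  rw [eE]
  exact chi_le_chi (Set.empty_subset _) ((Set.subset_univ _).trans Set.subset_union_left)

variable [Finite S]

theorem fac_fibBase_fam (W U V : Set S) (s v : S) {T : Set (insert s U : Set S)}
    {t : (insert s U : Set S)} (ht : t ∈ T) :
    Fac x (famIndex W V s v t)
      (fibBase (fam x W U V s v) T ≫
        x.map (homOfLE (chi_empty_le (chi (W \ (V \ {v})) (V \ {v})))).op) := by
  obtain ⟨a, ha⟩ := exists_fibBase_eq (fam x W U V s v) ht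
  rw [← ha, Category.assoc]
  refine Fac.comp ?_ a
  rw [fam, map_trans]
  exact fac_map _

theorem exists_comp_fibBase_fam (h₂ : IsMonic x) (W U V : Set S) (s v : S)
    {T : Set (insert s U : Set S)} {R : A} (f : R ⟶ x.obj (op (chi ∅ ∅)))
    (hf : Fac x (chi (W \ (V \ {v})) (V \ {v})) f) (hT : ∀ t ∈ T, Fac x (famIndex W V s v t) f) :
    ∃ l : R ⟶ (fib (fam x W U V s v)).obj (op T),
      l ≫ fibBase (fam x W U V s v) T ≫
        x.map (homOfLE (chi_empty_le (chi (W \ (V \ {v})) (V \ {v})))).op = f := by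
  obtain ⟨h, g, rfl⟩ := hf
  have := h₂ h
  obtain ⟨l, hl⟩ := exists_comp_fibBase (fam x W U V s v) T g fun t ht =>
    ((hT t ht).of_map h (le_famIndex W V s v t)).2
  exact ⟨l, by rw [← Category.assoc, hl]⟩

/-- If the vertex at `({s}, ∅)` distributes over sums as in the conclusion whenever `s ∉ W ∪ U ∪ V`,
then it does so for all `s`. -/
theorem InSpan.insert_of_disjoint {V : Set S}
    (h : ∀ W U : Set S, U.Nonempty → Disjoint U V → ∀ s ∉ W ∪ U, s ∉ V →
      ∀ ⦃R : A⦄ (f : R ⟶ x.obj (op (chi ∅ ∅))), Fac x (chi {s} ∅) f →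
        InSpan x (aboveMeeting W V U) (chi ∅ ∅) f →
        InSpan x (aboveMeeting (insert s W) V U) (chi ∅ ∅) f)
    {W U : Set S} (hUV : Disjoint U V) (s : S) {R : A} {f : R ⟶ x.obj (op (chi ∅ ∅))}
    (hfs : Fac x (chi {s} ∅) f) (hf : InSpan x (aboveMeeting W V U) (chi ∅ ∅) f) :
    InSpan x (aboveMeeting (insert s W) V U) (chi ∅ ∅) f := by
  by_cases hsW : s ∈ W
  · rwa [Set.insert_eq_of_mem hsW]
  by_cases hsV : s ∈ V
  · refine hf.mono fun j hj _ => ⟨j, ⟨?_, hj.2⟩, chi_empty_le _, le_rfl⟩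
    refine (chi_le_chi le_rfl ?_).trans hj.1
    exact Set.insert_subset (Or.inr hsV) Set.subset_union_left
  have key : ∀ U : Set S, Disjoint U V → s ∉ U →
      ∀ ⦃R : A⦄ (f : R ⟶ x.obj (op (chi ∅ ∅))), Fac x (chi {s} ∅) f →
        InSpan x (aboveMeeting W V U) (chi ∅ ∅) f →
        InSpan x (aboveMeeting (insert s W) V U) (chi ∅ ∅) f := by
    intro U hUV hsU R f hfs hf
    rcases U.eq_empty_or_nonempty with rfl | hU
    · exact hf.mono fun j ⟨_, k, hk, _⟩ _ => hk.elim
    · exact h W U hU hUV s (fun hs => hs.elim hsW hsU) hsV f hfs hf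
  by_cases hsU : s ∈ U
  -- The summand for `k = s` already takes the value 2 at `s`, so it belongs to the target span. It
  -- is split off, and the remainder involves only `U \ {s}`.
  · let i := chi W (insert s V)
    have hi : i ∈ aboveMeeting (insert s W) V U := by
      refine ⟨chi_le_chi (Set.subset_insert _ _) ?_, s, hsU, ?_⟩
      · exact Set.insert_subset (Or.inr (Set.mem_insert _ _)) Set.subset_union_left
      · exact chi_le_chi (Set.singleton_subset_iff.2 (Set.mem_insert _ _)) (Set.empty_subset _)
    have hf' : InSpan x (insert i (aboveMeeting W V (U \ {s}))) (chi ∅ ∅) f := by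
      refine hf.mono fun j ⟨hj, k, hk, hkj⟩ _ => ?_
      by_cases hks : k = s
      · refine ⟨i, Set.mem_insert _ _, chi_empty_le _, ?_⟩
        subst hks
        exact (chi_le_chi (by rw [Set.union_singleton])
          (Set.subset_union_left.trans Set.subset_union_left)).trans (chi_union_le hj hkj)
      · exact ⟨j, Set.mem_insert_of_mem _ ⟨hj, k, ⟨hk, hks⟩, hkj⟩, chi_empty_le _, le_rfl⟩
    have : Finite (Pow S (Fin 3)) := inferInstanceAs (Finite (S → Fin 3))
    obtain ⟨R', p, _, a, ha⟩ := hf'.exists_sub (chi_empty_le i)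
    apply InSpan.of_epi p
    have hai : Fac x i (a ≫ x.map (homOfLE (chi_empty_le i)).op) := (fac_map _).comp a
    rw [← sub_add_cancel (p ≫ f) (a ≫ x.map (homOfLE (chi_empty_le i)).op)]
    refine InSpan.add (InSpan.mono (J := aboveMeeting (insert s W) V (U \ {s})) ?_ ?_)
      (hai.inSpan hi)
    · refine key (U \ {s}) (hUV.mono_left Set.sdiff_subset) (fun hs => hs.2 rfl) _ ?_ ha
      -- The remainder still factors through `chi {s} ∅`, since both `f` and the summand split off
      -- do.
      refine (hfs.comp p).sub (hai.of_le (chi_empty_le _) (chi_le_chi (Set.empty_subset _) ?_))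
      exact Set.singleton_subset_iff.2 (Or.inr (Set.mem_insert _ _))
    · exact fun j ⟨hj, k, hk, hkj⟩ h => ⟨j, ⟨hj, k, hk.1, hkj⟩, h, le_rfl⟩
  · exact key U hUV hsU f hfs hf

variable [Nonempty S]

/-- `f` defines a class in $H_0\operatorname{Tot}$ of the backside `s`-face of the fibre product
cube. Its image for the frontside face vanishes because `f` lies in the given span, so `h` makes the
class itself vanish, which is the refined span membership. -/
theorem InSpan.insert_of_mono (h₁ : QuotientsMonic (pullback (twoMap S) x)) (h₂ : IsMonic x)
    (h₃ : ∀ T : Set S, T ≠ Set.univ → IsFibered (pullback (eMap T) x)) [LinearOrder S]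
    {W U V : Set S} {s v : S} (hs : s ∉ U)
    (h : Mono (homologyZeroTot (boundary (⟨s, Set.mem_insert s U⟩ : (insert s U : Set S))
      (fib (fam x W U V s v)))))
    {R : A} {f : R ⟶ x.obj (op (chi ∅ ∅))} (hfs : Fac x (chi {s} ∅) f)
    (hf : InSpan x (aboveMeeting W V U) (chi ∅ ∅) f) :
    InSpan x (aboveMeeting (insert s W) V U) (chi ∅ ∅) f := by
  let k₀ : (insert s U : Set S) := ⟨s, Set.mem_insert s U⟩
  let F := fib (fam x W U V s v)
  let b (T : Set (insert s U : Set S)) : F.obj (op T) ⟶ _ := fibBase (fam x W U V s v) T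
  have hb {T T' : Set (insert s U : Set S)} (h : T' ≤ T) : F.map (homOfLE h).op ≫ b T' = b T :=
    map_fibBase _ h
  have hsV : famIndex W V s v s = chi ((W ∪ {s}) \ (V \ {v})) (V \ {v}) := if_pos rfl
  have hkV : ∀ k ∈ U, famIndex W V s v k = chi (W \ (V ∪ {k})) (V ∪ {k}) := fun k hk =>
    if_neg fun e : k = s => hs (e ▸ hk)
  have hVV : V \ {v} ⊆ V := Set.sdiff_subset
  have hz : chi (W \ (V \ {v})) (V \ {v}) ≤ chi W V :=
    chi_le_chi hVV (Set.sdiff_subset.trans Set.subset_union_left)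
  have hz₀ := chi_empty_le (chi (W \ (V \ {v})) (V \ {v}))
  have := h₂ hz₀
  have := h₂ (chi_empty_le (chi W V))
  have hfWV : Fac x (chi W V) f := hf.fac (chi_empty_le _) fun k hk _ => hk.1
  -- `f` lies in the vertex at `chi W V`, hence in that at `chi (W ∪ {s}) V`; so it lifts to the
  -- vertex of the cube at `{s}`.
  obtain ⟨l, rfl⟩ := exists_comp_fibBase_fam h₂ W U V s v (T := faceMap k₀ {k₀} ∅) f
    (hfWV.of_le hz₀ hz) (by
      rintro t (⟨t, ht, rfl⟩ | rfl)
      · exact ht.elim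
      · change Fac x (famIndex W V s v s) f
        rw [hsV]
        refine (hfWV.union h₁ h₂ h₃ hfs).of_le (chi_empty_le _) (chi_le_chi ?_ ?_)
        · exact hVV.trans Set.subset_union_left
        · exact Set.sdiff_subset.trans Set.subset_union_left)
  have hl : ∀ ⦃Z : A⦄ (q : F.obj (op (faceMap k₀ ∅ ∅)) ⟶ Z), (∀ T, T.Nonempty →
      F.map (homOfLE ((faceMap k₀ ∅).monotone (Set.empty_subset T))).op ≫ q = 0) →
      l ≫ F.map (homOfLE (faceMap_le k₀ ∅)).op ≫ q = 0 := by
    intro Z q hq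
    have hi : IsIso (b (faceMap k₀ ∅ ∅)) := isIso_fibBase _ (by
      change Subtype.val '' ∅ ∪ ∅ = ∅
      rw [Set.image_empty, Set.union_empty])
    have e : F.map (homOfLE (faceMap_le k₀ ∅)).op ≫ q = b _ ≫ inv (b (faceMap k₀ ∅ ∅)) ≫ q := by
      rw [← hb (faceMap_le k₀ ∅), Category.assoc, IsIso.hom_inv_id_assoc]
    rw [e, ← Category.assoc]
    have h1 : InSpan x (aboveMeeting W V U) (chi (W \ (V \ {v})) (V \ {v})) (l ≫ b _) := by
      apply InSpan.of_map hz₀ fun k hk _ => hz.trans hk.1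
      rw [Category.assoc]
      exact hf
    refine h1 _ fun j hj hzj => ?_
    obtain ⟨hj, k, hk, hkj⟩ := hj
    let k' : {t : (insert s U : Set S) // t ≠ k₀} :=
      ⟨⟨k, Set.mem_insert_of_mem s hk⟩, fun e => by
        have e' : k = s := congrArg Subtype.val e
        exact hs (e' ▸ hk)⟩
    -- Each summand of the given span lifts to the vertex of the frontside face at `{k'}`, so `q`
    -- annihilates it.
    obtain ⟨l', hl'⟩ := exists_comp_fibBase_fam h₂ W U V s v (T := faceMap k₀ ∅ {k'})
      (x.map (homOfLE (chi_empty_le j)).op) ((fac_map _).of_le hz₀ hzj) (by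
        rintro t (⟨t, rfl, rfl⟩ | ht)
        · change Fac x (famIndex W V s v k) _
          rw [hkV k hk]
          refine (fac_map (chi_empty_le j)).of_le (chi_empty_le _) ?_
          refine (chi_le_chi le_rfl ?_).trans (chi_union_le hj hkj)
          exact Set.sdiff_subset.trans (Set.subset_union_left.trans Set.subset_union_left)
        · exact ht.elim)
    have h2 : l' ≫ b _ = x.map (homOfLE hzj).op := by
      rw [← cancel_mono (x.map (homOfLE hz₀).op), Category.assoc, map_trans]
      exact hl'
    rw [← h2, ← hb ((faceMap k₀ ∅).monotone (Set.empty_subset {k'})), Category.assoc,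
      Category.assoc, IsIso.hom_inv_id_assoc, hq _ (Set.singleton_nonempty _),
      comp_zero]
  have hl' : ∀ ⦃Z : A⦄ (q : F.obj (op (faceMap k₀ {k₀} ∅)) ⟶ Z), (∀ T, T.Nonempty →
      F.map (homOfLE ((faceMap k₀ {k₀}).monotone (Set.empty_subset T))).op ≫ q = 0) →
      l ≫ q = 0 := fun Z q hq =>
    InSpan.of_mono_homologyZeroTot (boundary k₀ F) l
      (fun Z q hq => (Category.assoc _ _ _).trans (hl q fun T hT => hq T hT (Set.empty_subset T))) q
      fun T hT _ => hq T hT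
  intro Z q hq
  rw [Category.assoc]
  apply hl'
  -- The vertex of the backside face at `T` maps into the vertices of both the `s`-th and the `k`-th
  -- source, hence into their intersection, inside the vertex at `chi (insert s W) (V ∪ {k})`, which
  -- `q` kills.
  rintro T ⟨k, hkT⟩
  have h5 := hb ((faceMap k₀ {k₀}).monotone (Set.empty_subset T))
  have hkU : k.1.1 ∈ U := k.1.2.resolve_left fun e => k.2 (Subtype.ext e)
  have h6 := fac_fibBase_fam (x := x) W U V s v (T := faceMap k₀ {k₀} T) (t := k₀) (Or.inr rfl)
  have h7 := fac_fibBase_fam (x := x) W U V s v (T := faceMap k₀ {k₀} T) (t := k.1)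
    (Or.inl ⟨k, hkT, rfl⟩)
  rw [hkV _ hkU] at h7
  change Fac x (famIndex W V s v s) _ at h6
  rw [hsV] at h6
  obtain ⟨h8, g, hg⟩ := (h6.union h₁ h₂ h₃ h7).of_le (k := chi (insert s W) (V ∪ {k.1.1}))
    (chi_empty_le _) (chi_le_chi Set.subset_union_right (by
      intro t ht
      by_cases htV : t ∈ V \ {v}
      · exact Or.inr (Or.inl htV)
      · exact Or.inl (Or.inl ⟨ht.elim Or.inr Or.inl, htV⟩)))
  have h9 : b (faceMap k₀ {k₀} T) ≫ x.map (homOfLE hz₀).op ≫ q = 0 := by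
    rw [← Category.assoc]
    refine (congrArg (· ≫ q) hg.symm).trans ?_
    rw [Category.assoc, hq _ ⟨?_, k.1.1, hkU, ?_⟩, comp_zero]
    · exact chi_le_chi Set.subset_union_left Set.subset_union_left
    · exact chi_le_chi Set.subset_union_right (Set.empty_subset _)
  rw [← h5, Category.assoc] at h9
  rw [Category.assoc]
  exact h9

end DoubleCube

end Cubes

theorem theorem4p8 {A : Type u} [Category.{v} A] [Abelian A]
    {S : Type w} [LinearOrder S] [Finite S] [Nonempty S] (x : Cubes.DCube S A)
    (h₁ : Cubes.IsAdmissible (Cubes.pullback (Cubes.twoMap S) x))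
    (h₂ : Cubes.IsMonic x)
    (h₃ : ∀ T : Set S, T ≠ Set.univ → Cubes.IsFibered (Cubes.pullback (Cubes.eMap T) x))
    (h₄ : ∀ W U V : Set S, U.Nonempty → V.Nonempty → Disjoint U V → W ∪ U ≠ Set.univ →
      ∀ s ∉ W ∪ U, ∀ v ∈ V, s ≠ v →
        Mono (Cubes.homologyZeroTot
          (Cubes.boundary (⟨s, Set.mem_insert s U⟩ : (insert s U : Set S))
            (Cubes.fib (Cubes.fam x W U V s v))))) :
    Cubes.IsAdmissible (Cubes.pullback (Cubes.eMap (Set.univ : Set S)) x) := by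
  have q₁ := h₁.quotientsMonic
  refine (Cubes.quotientsMonic_eMap_univ q₁ h₂ fun K T hT hKT R f hfs hf => ?_).isAdmissible
  -- `W` grows from `∅` to `S`. Each inserted `s` is allowed because `f` factors through every `chi
  -- {s} ∅`.
  have key (W : Set S) : Cubes.InSpan x (Cubes.aboveMeeting W T K) (Cubes.chi ∅ ∅) f := by
    induction W, W.toFinite using Set.Finite.induction_on with
    | empty => exact hf
    | @insert s W _ _ ih =>
      refine Cubes.InSpan.insert_of_disjoint (fun W U hU hUT s hs hsT R f hfs hf => ?_) hKT s
        (hfs s) ih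
      obtain ⟨v, hv⟩ := hT
      exact Cubes.InSpan.insert_of_mono q₁ h₂ h₃ (fun h => hs (Or.inr h))
        (h₄ W U T hU ⟨v, hv⟩ hUT (fun h => hs (h ▸ trivial)) s hs v hv
          (fun h => hsT (h ▸ hv))) hfs hf
  exact key Set.univ
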